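/- **Setting.** Fix integers $m,n\ge 0$. A mixed-integer linearly constrained quadratic program (MI-LCQP) with $m$ constraints and $n$ variables is $$\min_{x\in\mathbb R^n}\ \tfrac12 x^\top Qx+c^\top x\quad\text{s.t. } Ax\circ b,\ l\le x\le u,\ x_j\in\mathbb Z\ (j\in I),$$ with $Q\in\mathbb R^{n\times n}$ symmetric positive semidefinite, $c\in\mathbb R^n$, $A\in\mathbb R^{m\times n}$, $b\in\mathbb R^m$, $l\in(\mathbb R\cup\{-\infty\})^n$, $u\in(\mathbb R\cup\{+\infty\})^n$, $\circ\in\{\le,=,\ge\}^m$ and $I\subseteq\{1,\dots,n\}$. It is identified with the weighted graph $G$ that has constraint nodes $i\in V=\{1,\dots,m\}$ with features $v_i=(b_i,\circ_i)$, variable nodes $j\in W=\{1,\dots,n\}$ with features $w_j=(c_j,l_j,u_j,\delta_I(j))$, where $\delta_I(j)=1$ if $j\in I$ and $\delta_I(j)=0$ otherwise, and edge weights $A_{ij}\ne0$ (between $i$ and $j$) and $Q_{jj'}\neq 0$ (between $j$ and $j'$, loops allowed). Put $\mathcal N_i^W=\{j: A_{ij}\ne0\}$, $\mathcal N_j^V=\{i: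 A_{ij}\ne0\}$, $\mathcal N_j^W=\{j': Q_{jj'}\neq0\}$. Let $\mathcal G^{m,n}$ be the set of all such graphs, with the subspace topology of the product space of the data $(A,b,c,Q,l,u,\circ,I)$, where $\mathbb R\cup\{\pm\infty\}$ is the disjoint union of $\mathbb R$ and an isolated point, and $\{\le,=,\ge\}$ and $\{0,1\}$ (for $\delta_I$) are discrete. Let $\Phi_{\mathrm{obj}}(G)\in\mathbb R\cup\{\pm\infty\}$ be the infimum of the objective over the feasible set ($+\infty$ if infeasible, $-\infty$ if unbounded). **GNNs.** $\mathcal F$ is the class of maps $F$, defined on graphs of all sizes, of the following form, for some number of layers $L$ and arbitrary finite feature dimensions: $s_i^0=f_0^V(v_i)$, $t_j^0=f_0^W(w_j)$; for $1\le k\le L$ $$s_i^k=f_k^V\Big(s_i^{k-1},\sum_{j\in\mathcal N_i^W}g_k^W(t_j^{k-1},A_{ij})\Big),\qquad t_j^k=f_k^W\Big(t_j^{k-1},\sum_{i\in\mathcal N_j^V}g_k^V(s_i^{k-1},A_{ij}),\sum_{j'\in\mathcal N_j^W}g_k^Q(t_{j'}^{k-1},Q_{jj'})\Big);$$ and $F(G)=r\big(\sum_{i\in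 V}s_i^L,\sum_{j\in W}t_j^L\big)\in\mathbb R$, where all maps $f_k^V,f_k^W,g_k^V,g_k^W,g_k^Q,r$ are continuous. **MP-tractability.** The Weisfeiler–Lehman test without collisions starts with the colors $C_i^{0,V}=v_i$, $C_j^{0,W}=w_j$ and replaces them, at each iteration, by injective encodings of $$\big(C_i^{k-1,V},\{\!\{(C_j^{k-1,W},A_{ij}):j\in\mathcal N_i^W\}\!\}\big),\qquad \big(C_j^{k-1,W},\{\!\{(C_i^{k-1,V},A_{ij}):i\in\mathcal N_j^V\}\!\},\{\!\{(C_{j'}^{k-1,W},Q_{jj'}):j'\in\mathcal N_j^W\}\!\}\big).$$ The partitions of $V$ and $W$ by color become stable; let $V=\bigsqcup_p I_p$, $W=\bigsqcup_q J_q$ be the final stable partitions. $G$ is *MP-tractable* if, for all $p,q,q'$, $A_{ij}$ is constant over $i\in I_p,\ j\in J_q$, and $Q_{jj'}$ is constant over $j\in J_q,\ j'\in J_{q'}$. **Theorem.** Let $\mathbb P$ be a Borel regular probability measure on $\mathcal G^{m,n}$ with $\mathbb P[G\text{ is MP-tractable}]=1$. 1. For every $\epsilon>0$ there is $F_1\in\mathcal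 F$ such that $$\mathbb P\big[\mathbb I_{F_1(G)>1/2}\ne\mathbb I_{\Phi_{\mathrm{obj}}(G)\in\mathbb R}\big]<\epsilon .$$ 2. If $\mathbb P[\Phi_{\mathrm{obj}}(G)\in\mathbb R]=1$, then for all $\epsilon,\delta>0$ there is $F_2\in\mathcal F$ such that $$\mathbb P\big[|F_2(G)-\Phi_{\mathrm{obj}}(G)|>\delta\big]<\epsilon .$$ -/

import Mathlib

open MeasureTheory
open scoped Matrix ENNReal

noncomputable section

namespace QPGNN

/-- The three kinds of linear constraint. -/
inductive ConRel : Type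
  | le
  | eq
  | ge

instance : TopologicalSpace ConRel := ⊥

instance : DiscreteTopology ConRel := ⟨rfl⟩

/-- `a ∘ b` for a constraint kind `∘`. -/
def ConRel.Holds : ConRel → ℝ → ℝ → Prop
  | .le, a, b => a ≤ b
  | .eq, a, b => a = b
  | .ge, a, b => b ≤ a

/-- `ℝ ∪ {∞}` with one extra point (`-∞` for lower bounds, `+∞` for upper bounds). As a sum type it
carries the topology of the disjoint union of `ℝ` and an isolated point. -/
abbrev RealOrInf : Type := ℝ ⊕ Unit

/-- `l ≤ x`, where the extra point of `l` is `-∞`. -/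
def RealOrInf.LowerHolds : RealOrInf → ℝ → Prop
  | .inl a, x => a ≤ x
  | .inr _, _ => True

/-- `x ≤ u`, where the extra point of `u` is `+∞`. -/
def RealOrInf.UpperHolds : RealOrInf → ℝ → Prop
  | .inl a, x => x ≤ a
  | .inr _, _ => True

/-- Features `(bᵢ, ∘ᵢ)` of constraint nodes. -/
abbrev ConFeat : Type := ℝ × ConRel

/-- Features `(cⱼ, lⱼ, uⱼ, δ_I(j))` of variable nodes. -/
abbrev VarFeat : Type := ℝ × RealOrInf × RealOrInf × Bool

/-- Mixed-integer linearly constrained (convex) quadratic programs with `m` constraints and `n`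
variables, `min ½ xᵀQx + cᵀx` subject to `Ax ∘ b`, `l ≤ x ≤ u`, `xⱼ ∈ ℤ` whenever `isInt j`.
The same data is the weighted graph with constraint nodes `Fin m` and variable nodes `Fin n`. -/
structure MILCQP (m n : ℕ) where
  A : Matrix (Fin m) (Fin n) ℝ
  b : Fin m → ℝ
  c : Fin n → ℝ
  Q : Matrix (Fin n) (Fin n) ℝ
  l : Fin n → RealOrInf
  u : Fin n → RealOrInf
  rel : Fin m → ConRel
  isInt : Fin n → Bool
  posSemidef : Q.PosSemidef

namespace MILCQP

variable {m n : ℕ}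

/-- All the data of an instance, as a point of a product space. -/
def data (G : MILCQP m n) :
    Matrix (Fin m) (Fin n) ℝ × (Fin m → ℝ) × (Fin n → ℝ) × Matrix (Fin n) (Fin n) ℝ ×
      (Fin n → RealOrInf) × (Fin n → RealOrInf) × (Fin m → ConRel) × (Fin n → Bool) :=
  (G.A, G.b, G.c, G.Q, G.l, G.u, G.rel, G.isInt)

/-- The subspace topology of the product topology. -/
instance : TopologicalSpace (MILCQP m n) := TopologicalSpace.induced data inferInstance

instance : MeasurableSpace (MILCQP m n) := borel (MILCQP m n)

instance : BorelSpace (MILCQP m n) := ⟨rfl⟩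

/-! Optimization problem. -/

def Feasible (G : MILCQP m n) (x : Fin n → ℝ) : Prop :=
  (∀ i, (G.rel i).Holds ((G.A *ᵥ x) i) (G.b i)) ∧
  (∀ j, (G.l j).LowerHolds (x j)) ∧
  (∀ j, (G.u j).UpperHolds (x j)) ∧
  (∀ j, G.isInt j = true → ∃ z : ℤ, x j = z)

def objective (G : MILCQP m n) (x : Fin n → ℝ) : ℝ :=
  1 / 2 * (x ⬝ᵥ (G.Q *ᵥ x)) + G.c ⬝ᵥ x

/-- The optimal objective value: the infimum of the objective over the feasible set, which is `+∞`
for an infeasible instance and `-∞` for an unbounded one. -/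
def optValue (G : MILCQP m n) : EReal :=
  ⨅ (x : Fin n → ℝ) (_ : G.Feasible x), ((G.objective x : ℝ) : EReal)

/-- The optimal objective value is a real number. -/
def HasFiniteValue (G : MILCQP m n) : Prop :=
  ∃ r : ℝ, G.optValue = (r : EReal)

/-! Graph structure. -/

def conFeat (G : MILCQP m n) (i : Fin m) : ConFeat := (G.b i, G.rel i)

def varFeat (G : MILCQP m n) (j : Fin n) : VarFeat := (G.c j, G.l j, G.u j, G.isInt j)

/-- The variable nodes adjacent to the constraint node `i`. -/
def conNbrs (G : MILCQP m n) (i : Fin m) : Finset (Fin n) :=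
  Finset.univ.filter fun j => G.A i j ≠ 0

/-- The constraint nodes adjacent to the variable node `j`. -/
def varConNbrs (G : MILCQP m n) (j : Fin n) : Finset (Fin m) :=
  Finset.univ.filter fun i => G.A i j ≠ 0

/-- The variable nodes adjacent to the variable node `j` (possibly `j` itself). -/
def varVarNbrs (G : MILCQP m n) (j : Fin n) : Finset (Fin n) :=
  Finset.univ.filter fun j' => G.Q j j' ≠ 0

end MILCQP

/-! The Weisfeiler-Lehman test without collisions: a colour is literally the data that would be
hashed, so that equality of colours is equality of these data. -/

/-- The types of the colours of constraint nodes and of variable nodes after `k` iterations. -/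
def WLColor : ℕ → Type × Type
  | 0 => (ConFeat, VarFeat)
  | k + 1 =>
    ((WLColor k).1 × Multiset ((WLColor k).2 × ℝ),
     (WLColor k).2 × Multiset ((WLColor k).1 × ℝ) × Multiset ((WLColor k).2 × ℝ))

namespace MILCQP

variable {m n : ℕ}

/-- The colours of all constraint nodes and of all variable nodes after `k` iterations. -/
def wl (G : MILCQP m n) : (k : ℕ) → (Fin m → (WLColor k).1) × (Fin n → (WLColor k).2)
  | 0 => (G.conFeat, G.varFeat)
  | k + 1 =>
    (fun i => ((G.wl k).1 i, (G.conNbrs i).val.map fun j => ((G.wl k).2 j, G.A i j)),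
     fun j => ((G.wl k).2 j,
       (G.varConNbrs j).val.map fun i => ((G.wl k).1 i, G.A i j),
       (G.varVarNbrs j).val.map fun j' => ((G.wl k).2 j', G.Q j j')))

/-- Two constraint nodes lie in the same class of the final stable partition. Colours are only ever
refined, so this means that they have the same colour after every number of iterations. -/
def SameClassCon (G : MILCQP m n) (i i' : Fin m) : Prop :=
  ∀ k, (G.wl k).1 i = (G.wl k).1 i'

/-- Two variable nodes lie in the same class of the final stable partition. -/
def SameClassVar (G : MILCQP m n) (j j' : Fin n) : Prop :=
  ∀ k, (G.wl k).2 j = (G.wl k).2 j'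

/-- Message-passing tractability: `A` is constant on each block `I_p × J_q` and `Q` is constant on
each block `J_q × J_q'` of the final stable partition. -/
def MPTractable (G : MILCQP m n) : Prop :=
  (∀ i i' j j', G.SameClassCon i i' → G.SameClassVar j j' → G.A i j = G.A i' j') ∧
  (∀ j₁ j₁' j₂ j₂', G.SameClassVar j₁ j₁' → G.SameClassVar j₂ j₂' → G.Q j₁ j₂ = G.Q j₁' j₂')

end MILCQP

/-- Message-passing graph neural networks with graph-level output. They do not refer to the size
of the input graph. The features after `k` layers are vectors in `ℝ^(dV k)` and `ℝ^(dW k)`; all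
dimensions are arbitrary. The maps indexed by `k` are those of layer `k + 1`; only the
ones with `k < L` are used. -/
structure GNN where
  L : ℕ
  dV : ℕ → ℕ
  dW : ℕ → ℕ
  eW : ℕ → ℕ
  eV : ℕ → ℕ
  eQ : ℕ → ℕ
  f0V : C(ConFeat, Fin (dV 0) → ℝ)
  f0W : C(VarFeat, Fin (dW 0) → ℝ)
  gW : ∀ k, C((Fin (dW k) → ℝ) × ℝ, Fin (eW k) → ℝ)
  gV : ∀ k, C((Fin (dV k) → ℝ) × ℝ, Fin (eV k) → ℝ)
  gQ : ∀ k, C((Fin (dW k) → ℝ) × ℝ, Fin (eQ k) → ℝ)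
  fV : ∀ k, C((Fin (dV k) → ℝ) × (Fin (eW k) → ℝ), Fin (dV (k + 1)) → ℝ)
  fW : ∀ k, C((Fin (dW k) → ℝ) × (Fin (eV k) → ℝ) × (Fin (eQ k) → ℝ), Fin (dW (k + 1)) → ℝ)
  r : C((Fin (dV L) → ℝ) × (Fin (dW L) → ℝ), ℝ)

namespace GNN

variable {m n : ℕ}

/-- The features of all constraint nodes and of all variable nodes after `k` layers. -/
def features (F : GNN) (G : MILCQP m n) :
    (k : ℕ) → (Fin m → Fin (F.dV k) → ℝ) × (Fin n → Fin (F.dW k) → ℝ)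
  | 0 => (fun i => F.f0V (G.conFeat i), fun j => F.f0W (G.varFeat j))
  | k + 1 =>
    (fun i => F.fV k ((F.features G k).1 i,
       ∑ j ∈ G.conNbrs i, F.gW k ((F.features G k).2 j, G.A i j)),
     fun j => F.fW k ((F.features G k).2 j,
       ∑ i ∈ G.varConNbrs j, F.gV k ((F.features G k).1 i, G.A i j),
       ∑ j' ∈ G.varVarNbrs j, F.gQ k ((F.features G k).2 j', G.Q j j')))

/-- The output of the network on an instance. -/
def eval (F : GNN) (G : MILCQP m n) : ℝ :=
  F.r (∑ i, (F.features G F.L).1 i, ∑ j, (F.features G F.L).2 j)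

end GNN

end QPGNN

end

noncomputable section

namespace QPGNN

/-! Two MP-tractable instances with the same multisets of stable colours differ only by a
relabelling of nodes, because block-constant weights can be read off the coloured neighbourhoods.
Hence the colours determine the optimal value (`MPTractable.optValue_eq`).

One network computes a continuous graph invariant `wlReadout` that determines these multisets
(`map_wl_eq_of_wlReadout_eq`). Its messages and updates are weighted polynomial moments, whose sums
are injective on multisets of bounded size (`exists_multiset_encoding`). The messages vanish at
weight zero, so features stay continuous when an edge disappears.

It remains to choose the readout. The optimal value is Borel measurable (`measurable_optValue`), so
Lusin's theorem gives a compact set of tractable instances, of nearly full measure, on which the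
target is continuous. There the target factors through `wlReadout`, and compactness with Tietze's
theorem makes the factor a continuous readout (`exists_continuousMap_comp_eqOn`). The network is
thus exact off a set of small measure. -/

/-- Finitely many continuous real-valued functions separate the points of `X`. -/
class FiniteCoords (X : Type) [TopologicalSpace X] : Prop where
  exists_coords : ∃ (d : ℕ) (h : Fin d → C(X, ℝ)), ∀ x y, (∀ i, h i x = h i y) → x = y

theorem FiniteCoords.of_fintype {X I : Type} [TopologicalSpace X] [Fintype I] (h : I → C(X, ℝ))
    (hsep : ∀ x y, (∀ i, h i x = h i y) → x = y) : FiniteCoords X where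
  exists_coords := ⟨Fintype.card I, fun i => h ((Fintype.equivFin I).symm i), fun x y hxy =>
    hsep x y fun i => by simpa using hxy (Fintype.equivFin I i)⟩

instance : FiniteCoords ℝ :=
  .of_fintype (I := Unit) (fun _ => .id ℝ) fun _ _ h => h ()

instance : FiniteCoords Bool :=
  .of_fintype (I := Unit) (fun _ => ⟨fun b => if b then 1 else 0, continuous_of_discreteTopology⟩)
    fun x y h => by
      have := h ()
      revert this
      cases x <;> cases y <;> simp

instance : FiniteCoords ConRel :=
  .of_fintype (I := Unit)
    (fun _ => ⟨fun r => match r with | .le => 0 | .eq => 1 | .ge => 2,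
      continuous_of_discreteTopology⟩)
    fun x y h => by
      have := h ()
      revert this
      cases x <;> cases y <;> simp

instance (d : ℕ) : FiniteCoords (Fin d → ℝ) :=
  .of_fintype (I := Fin d) (fun i => ⟨fun x => x i, continuous_apply i⟩) fun _ _ h => funext h

instance {X Y : Type} [TopologicalSpace X] [TopologicalSpace Y] [FiniteCoords X]
    [FiniteCoords Y] : FiniteCoords (X × Y) := by
  obtain ⟨d, h, hh⟩ := FiniteCoords.exists_coords (X := X)
  obtain ⟨d', h', hh'⟩ := FiniteCoords.exists_coords (X := Y)
  refine .of_fintype (I := Fin d ⊕ Fin d') (Sum.elim (fun i => (h i).comp .fst)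
    fun i => (h' i).comp .snd) fun x y hxy => Prod.ext ?_ ?_
  · exact hh _ _ fun i => hxy (.inl i)
  · exact hh' _ _ fun i => hxy (.inr i)

/-- The finite part of an extended real (`0` at the extra point). -/
def RealOrInf.value : C(RealOrInf, ℝ) := ⟨Sum.elim id fun _ => 0, by fun_prop⟩

/-- The indicator of the extra point. -/
def RealOrInf.isInf : C(RealOrInf, ℝ) := ⟨Sum.elim (fun _ => 0) fun _ => 1, by fun_prop⟩

instance : FiniteCoords RealOrInf :=
  .of_fintype (I := Bool) (fun b => if b then RealOrInf.value else RealOrInf.isInf)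
    fun x y h => by
      have h₁ := h true
      have h₂ := h false
      revert h₁ h₂
      rcases x with x | x <;> rcases y with y | y <;> simp [RealOrInf.value, RealOrInf.isInf]

/-! ### Moment encodings of multisets -/

/-- Products of `M` factors, each of which is one of the functions `h i` or the constant `1`. -/
def monomial {X : Type} [TopologicalSpace X] {d : ℕ} (h : Fin d → C(X, ℝ)) {M : ℕ}
    (e : Fin M → Option (Fin d)) : C(X, ℝ) :=
  ∏ k, (e k).elim 1 h

/-- Each point of `S` differs from `z` in some coordinate, giving a linear factor that vanishes at
that point but not at `z`. Their product, padded by ones to `M` factors, expands into monomials. -/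
theorem exists_polynomial_eq_zero_on_finset {X : Type} [TopologicalSpace X] {d : ℕ}
    {h : Fin d → C(X, ℝ)} (hsep : ∀ x y, (∀ i, h i x = h i y) → x = y) {M : ℕ}
    {S : Finset X} (hS : S.card ≤ M) {z : X} (hz : z ∉ S) :
    ∃ a : (Fin M → Option (Fin d)) → ℝ, (∑ e, a e * monomial h e z ≠ 0) ∧
      ∀ x ∈ S, ∑ e, a e * monomial h e x = 0 := by
  classical
  have hc : ∀ w : S, ∃ i, h i w ≠ h i z := fun w => by
    by_contra! H
    exact hz (hsep _ _ H ▸ w.2)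
  choose c hc using hc
  obtain ⟨f⟩ : Nonempty (S ↪ Fin M) :=
    Function.Embedding.nonempty_of_card_le (by simpa using hS)
  let u : Fin M → Option S := Function.partialInv f
  -- the `k`-th factor is `h (c w) - h (c w) w` if `u k = some w`, and `1` if `u k = none`
  let coef : Fin M → Option (Fin d) → ℝ := fun k o =>
    match u k, o with
    | none, none => 1
    | none, some _ => 0
    | some w, none => -h (c w) w
    | some w, some i => if i = c w then 1 else 0
  have key : ∀ x, ∑ e : Fin M → Option (Fin d), (∏ k, coef k (e k)) * monomial h e x
      = ∏ k, ∑ o, coef k o * (o.elim (1 : C(X, ℝ)) h) x := fun x => by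
    rw [Finset.prod_univ_sum, Fintype.piFinset_univ]
    refine Finset.sum_congr rfl fun e _ => ?_
    rw [Finset.prod_mul_distrib, monomial, ContinuousMap.prod_apply]
  have factor_some : ∀ k w, u k = some w → ∀ x,
      ∑ o, coef k o * (o.elim (1 : C(X, ℝ)) h) x = h (c w) x - h (c w) w := fun k w hk x => by
    rw [Fintype.sum_option]
    simp [coef, hk]
    ring
  have factor_none : ∀ k, u k = none → ∀ x,
      ∑ o, coef k o * (o.elim (1 : C(X, ℝ)) h) x = 1 := fun k hk x => by
    rw [Fintype.sum_option]
    simp [coef, hk]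
  refine ⟨fun e => ∏ k, coef k (e k), ?_, fun x hx => ?_⟩
  · rw [key, Finset.prod_ne_zero_iff]
    intro k _
    rcases hk : u k with _ | w
    · rw [factor_none k hk]
      exact one_ne_zero
    · rw [factor_some k w hk, sub_ne_zero]
      exact (hc w).symm
  · rw [key]
    refine Finset.prod_eq_zero (Finset.mem_univ (f ⟨x, hx⟩)) ?_
    rw [factor_some _ ⟨x, hx⟩ (Function.partialInv_left f.injective _)]
    simp

/-- Multisets of bounded size are determined by finitely many weighted continuous moments. -/
theorem exists_multiset_encoding {X : Type} [TopologicalSpace X] [FiniteCoords X] (w : C(X, ℝ))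
    (N : ℕ) : ∃ (D : ℕ) (g : C(X, Fin D → ℝ)), (∀ x, w x = 0 → g x = 0) ∧
      ∀ s t : Multiset X, s.card ≤ N → t.card ≤ N → (∀ x ∈ s, w x ≠ 0) → (∀ x ∈ t, w x ≠ 0) →
        (s.map g).sum = (t.map g).sum → s = t := by
  classical
  obtain ⟨d, h, hsep⟩ := FiniteCoords.exists_coords (X := X)
  let E := Fintype.equivFin (Fin (N + N) → Option (Fin d))
  refine ⟨_, ⟨fun x i => w x * monomial h (E.symm i) x, by fun_prop⟩, fun x hx => ?_,
    fun s t hs ht hws hwt hst => ?_⟩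
  · ext i
    simp [hx]
  have moments : ∀ a : (Fin (N + N) → Option (Fin d)) → ℝ,
      (s.map fun x => w x * ∑ e, a e * monomial h e x).sum
        = (t.map fun x => w x * ∑ e, a e * monomial h e x).sum := fun a => by
    let L : (Fin (Fintype.card (Fin (N + N) → Option (Fin d))) → ℝ) →+ ℝ :=
      { toFun := fun v => ∑ i, a (E.symm i) * v i
        map_zero' := by simp
        map_add' := fun v v' => by simp [mul_add, Finset.sum_add_distrib] }
    have hL : ∀ x, L (fun i => w x * monomial h (E.symm i) x)
        = w x * ∑ e, a e * monomial h e x := fun x => by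
      rw [Finset.mul_sum, ← E.symm.sum_comp]
      change ∑ i, a (E.symm i) * (w x * monomial h (E.symm i) x) = _
      exact Finset.sum_congr rfl fun i _ => mul_left_comm _ _ _
    have := congrArg L hst
    rw [map_multiset_sum, map_multiset_sum, Multiset.map_map, Multiset.map_map] at this
    simpa only [Function.comp_def, ContinuousMap.coe_mk, hL] using this
  by_contra hne
  obtain ⟨z, hz⟩ : ∃ z, s.count z ≠ t.count z := by
    by_contra! H
    exact hne (Multiset.ext.2 H)
  -- `s + t` has at most `N + N` distinct points, which is why monomials with that many factors
  -- suffice.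
  obtain ⟨a, haz, ha⟩ := exists_polynomial_eq_zero_on_finset hsep (M := N + N)
    (S := (s + t).toFinset.erase z) (z := z)
    ((Finset.card_le_card (Finset.erase_subset _ _)).trans
      ((Multiset.toFinset_card_le _).trans (by rw [Multiset.card_add]; omega))) (by simp)
  have hwz : w z ≠ 0 := by
    by_cases hzs : z ∈ s
    · exact hws z hzs
    by_cases hzt : z ∈ t
    · exact hwt z hzt
    exact absurd ((Multiset.count_eq_zero_of_notMem hzs).trans
      (Multiset.count_eq_zero_of_notMem hzt).symm) hz
  -- Only the copies of `z` contribute to this moment, so it compares the two multiplicities of `z`.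
  have := moments a
  rw [Multiset.sum_map_eq_nsmul_single z fun x hxz hx => by
      rw [ha x (by simp [hxz, hx]), mul_zero],
    Multiset.sum_map_eq_nsmul_single z fun x hxz hx => by
      rw [ha x (by simp [hxz, hx]), mul_zero], nsmul_eq_mul, nsmul_eq_mul] at this
  exact hz (by exact_mod_cast mul_right_cancel₀ (mul_ne_zero hwz haz) this)

/-- The number of moments used by `encoding`. -/
def encodingDim {X : Type} [TopologicalSpace X] [FiniteCoords X] (w : C(X, ℝ)) (N : ℕ) : ℕ :=
  (exists_multiset_encoding w N).choose

/-- A continuous map whose sums determine multisets of at most `N` points with nonzero weight. -/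
def encoding {X : Type} [TopologicalSpace X] [FiniteCoords X] (w : C(X, ℝ)) (N : ℕ) :
    C(X, Fin (encodingDim w N) → ℝ) :=
  (exists_multiset_encoding w N).choose_spec.choose

section encoding

variable {X : Type} [TopologicalSpace X] [FiniteCoords X] {w : C(X, ℝ)} {N : ℕ}

theorem encoding_eq_zero {x : X} (hx : w x = 0) : encoding w N x = 0 :=
  (exists_multiset_encoding w N).choose_spec.choose_spec.1 x hx

theorem map_eq_map_of_sum_encoding_eq {ι ι' : Type} {s : Finset ι} {t : Finset ι'} {f : ι → X}
    {f' : ι' → X} (hs : s.card ≤ N) (ht : t.card ≤ N) (hws : ∀ i ∈ s, w (f i) ≠ 0)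
    (hwt : ∀ i ∈ t, w (f' i) ≠ 0)
    (hst : ∑ i ∈ s, encoding w N (f i) = ∑ i ∈ t, encoding w N (f' i)) :
    s.val.map f = t.val.map f' := by
  refine (exists_multiset_encoding w N).choose_spec.choose_spec.2 _ _ (by simpa using hs)
    (by simpa using ht) (by simpa using hws) (by simpa using hwt) ?_
  rw [Multiset.map_map, Multiset.map_map]
  exact hst

theorem encoding_injective (hN : 1 ≤ N) {x y : X} (hx : w x ≠ 0) (hy : w y ≠ 0)
    (hxy : encoding w N x = encoding w N y) : x = y := by
  have := map_eq_map_of_sum_encoding_eq (w := w) (N := N) (s := {()}) (t := {()})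
    (f := fun _ => x) (f' := fun _ => y) (by simpa) (by simpa) (by simpa) (by simpa) (by simpa)
  simpa using this

end encoding

/-- If `f` determines `g`, then equality of multisets of values of `f` gives the same for `g`. -/
theorem map_eq_map_of_imp {ι ι' α β : Type*} {s : Multiset ι} {t : Multiset ι'} {f : ι → α}
    {f' : ι' → α} {g : ι → β} {g' : ι' → β} (h : s.map f = t.map f')
    (hfg : ∀ i i', f i = f' i' → g i = g' i') : s.map g = t.map g' := by
  rw [← Multiset.rel_eq, Multiset.rel_map] at h ⊢
  exact h.mono fun i _ i' _ => hfg i i'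

theorem map_prodMk_eq_of_imp {ι ι' α β γ : Type*} {s : Multiset ι} {t : Multiset ι'} {f : ι → α}
    {f' : ι' → α} {g : ι → β} {g' : ι' → β} {a : ι → γ} {a' : ι' → γ}
    (h : (s.map fun i => (f i, a i)) = t.map fun i => (f' i, a' i))
    (hfg : ∀ i i', f i = f' i' → g i = g' i') :
    (s.map fun i => (g i, a i)) = t.map fun i => (g' i, a' i) :=
  map_eq_map_of_imp h fun i i' hi =>
    Prod.ext (hfg i i' (congrArg Prod.fst hi)) (congrArg Prod.snd hi :)

/-! A network whose features determine the colours of the Weisfeiler-Lehman test. -/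

/-- The dimension of messages sent along edges by nodes with features in `ℝ^d`. -/
def msgDim (N d : ℕ) : ℕ := encodingDim (X := (Fin d → ℝ) × ℝ) .snd N

/-- The message sent along an edge; it vanishes when the edge weight does. -/
def msg (N d : ℕ) : C((Fin d → ℝ) × ℝ, Fin (msgDim N d) → ℝ) := encoding .snd N

/-- The dimensions of the features of constraint nodes and of variable nodes. -/
def wlDim (N : ℕ) : ℕ → ℕ × ℕ
  | 0 => (encodingDim (X := ConFeat) 1 N, encodingDim (X := VarFeat) 1 N)
  | k + 1 =>
    (encodingDim (X := (Fin (wlDim N k).1 → ℝ) × (Fin (msgDim N (wlDim N k).2) → ℝ)) 1 N,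
     encodingDim (X := (Fin (wlDim N k).2 → ℝ) × (Fin (msgDim N (wlDim N k).1) → ℝ) ×
       (Fin (msgDim N (wlDim N k).2) → ℝ)) 1 N)

/-- A network with `L` layers that simulates the Weisfeiler-Lehman test on graphs with at most `N`
nodes, with an arbitrary readout. -/
def wlGNN (N L : ℕ) (r : C((Fin (wlDim N L).1 → ℝ) × (Fin (wlDim N L).2 → ℝ), ℝ)) : GNN where
  L := L
  dV k := (wlDim N k).1
  dW k := (wlDim N k).2
  eW k := msgDim N (wlDim N k).2
  eV k := msgDim N (wlDim N k).1
  eQ k := msgDim N (wlDim N k).2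
  f0V := encoding 1 N
  f0W := encoding 1 N
  gW _ := msg N _
  gV _ := msg N _
  gQ _ := msg N _
  -- Using an encoding as the update, too, makes it injective and lets the final sum over nodes
  -- determine the multiset of features.
  fV _ := encoding 1 N
  fW _ := encoding 1 N
  r := r

variable {m n : ℕ}

/-- The features computed by `wlGNN`. -/
def wlFeatures (N : ℕ) (G : MILCQP m n) :
    (k : ℕ) → (Fin m → Fin (wlDim N k).1 → ℝ) × (Fin n → Fin (wlDim N k).2 → ℝ)
  | 0 => (fun i => encoding 1 N (G.conFeat i), fun j => encoding 1 N (G.varFeat j))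
  | k + 1 =>
    (fun i => encoding 1 N ((wlFeatures N G k).1 i,
       ∑ j ∈ G.conNbrs i, msg N _ ((wlFeatures N G k).2 j, G.A i j)),
     fun j => encoding 1 N ((wlFeatures N G k).2 j,
       ∑ i ∈ G.varConNbrs j, msg N _ ((wlFeatures N G k).1 i, G.A i j),
       ∑ j' ∈ G.varVarNbrs j, msg N _ ((wlFeatures N G k).2 j', G.Q j j')))

theorem features_wlGNN (N L : ℕ) (r) (G : MILCQP m n) (k : ℕ) :
    (wlGNN N L r).features G k = wlFeatures N G k := by
  induction k with
  | zero => rfl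
  | succ k ih =>
    simp only [GNN.features, wlFeatures, ih]
    rfl

/-- The argument of the readout of `wlGNN`. -/
def wlReadout (N L : ℕ) (G : MILCQP m n) :
    (Fin (wlDim N L).1 → ℝ) × (Fin (wlDim N L).2 → ℝ) :=
  (∑ i, (wlFeatures N G L).1 i, ∑ j, (wlFeatures N G L).2 j)

theorem eval_wlGNN (N L : ℕ) (r) (G : MILCQP m n) :
    (wlGNN N L r).eval G = r (wlReadout N L G) := by
  have := features_wlGNN N L r G L
  unfold GNN.eval wlReadout
  rw [← this]
  rfl

/-! Continuity. -/

namespace MILCQP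

theorem continuous_data : Continuous (data : MILCQP m n → _) := continuous_induced_dom

theorem data_injective : Function.Injective (data : MILCQP m n → _) := by
  rintro ⟨A, b, c, Q, l, u, rel, isInt, h⟩ ⟨A', b', c', Q', l', u', rel', isInt', h'⟩ hd
  simp only [data, Prod.mk.injEq] at hd
  obtain ⟨rfl, rfl, rfl, rfl, rfl, rfl, rfl, rfl⟩ := hd
  rfl

instance : T2Space (MILCQP m n) := T2Space.of_injective_continuous data_injective continuous_data

@[fun_prop]
theorem continuous_A : Continuous fun G : MILCQP m n => G.A :=
  continuous_fst.comp continuous_data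

@[fun_prop]
theorem continuous_b : Continuous fun G : MILCQP m n => G.b :=
  (continuous_fst.comp continuous_snd).comp continuous_data

@[fun_prop]
theorem continuous_c : Continuous fun G : MILCQP m n => G.c :=
  (continuous_fst.comp (continuous_snd.comp continuous_snd)).comp continuous_data

@[fun_prop]
theorem continuous_Q : Continuous fun G : MILCQP m n => G.Q :=
  (continuous_fst.comp (continuous_snd.comp (continuous_snd.comp continuous_snd))).comp
    continuous_data

@[fun_prop]
theorem continuous_l : Continuous fun G : MILCQP m n => G.l :=
  (continuous_fst.comp (continuous_snd.comp (continuous_snd.comp (continuous_snd.comp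
    continuous_snd)))).comp continuous_data

@[fun_prop]
theorem continuous_u : Continuous fun G : MILCQP m n => G.u :=
  (continuous_fst.comp (continuous_snd.comp (continuous_snd.comp (continuous_snd.comp
    (continuous_snd.comp continuous_snd))))).comp continuous_data

@[fun_prop]
theorem continuous_rel : Continuous fun G : MILCQP m n => G.rel :=
  (continuous_fst.comp (continuous_snd.comp (continuous_snd.comp (continuous_snd.comp
    (continuous_snd.comp (continuous_snd.comp continuous_snd)))))).comp continuous_data

@[fun_prop]
theorem continuous_isInt : Continuous fun G : MILCQP m n => G.isInt :=
  (continuous_snd.comp (continuous_snd.comp (continuous_snd.comp (continuous_snd.comp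
    (continuous_snd.comp (continuous_snd.comp continuous_snd)))))).comp continuous_data

@[fun_prop]
theorem continuous_A_apply (i : Fin m) (j : Fin n) : Continuous fun G : MILCQP m n => G.A i j :=
  continuous_A.matrix_elem i j

@[fun_prop]
theorem continuous_Q_apply (j j' : Fin n) : Continuous fun G : MILCQP m n => G.Q j j' :=
  continuous_Q.matrix_elem j j'

end MILCQP

/-- The neighbourhood jumps when a weight reaches zero, but the message vanishes there, so the sum
may be taken over all nodes. -/
theorem continuous_sum_msg {ι Y : Type} [Fintype ι] [TopologicalSpace Y] (N d : ℕ)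
    {t : Y → ι → Fin d → ℝ} {a : Y → ι → ℝ} (ht : ∀ i, Continuous fun y => t y i)
    (ha : ∀ i, Continuous fun y => a y i) :
    Continuous fun y => ∑ i ∈ Finset.univ.filter (fun i => a y i ≠ 0), msg N d (t y i, a y i) := by
  have h : ∀ y, ∑ i ∈ Finset.univ.filter (fun i => a y i ≠ 0), msg N d (t y i, a y i)
      = ∑ i, msg N d (t y i, a y i) := fun y =>
    Finset.sum_filter_of_ne fun _ _ h ha => h (encoding_eq_zero ha)
  simp only [h]
  exact continuous_finsetSum _ fun i _ => (msg N d).continuous.comp ((ht i).prodMk (ha i))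

theorem continuous_wlFeatures (N k : ℕ) :
    (∀ i, Continuous fun G : MILCQP m n => (wlFeatures N G k).1 i) ∧
      ∀ j, Continuous fun G : MILCQP m n => (wlFeatures N G k).2 j := by
  induction k with
  | zero =>
    have hV : ∀ i, Continuous fun G : MILCQP m n => G.conFeat i := fun i => by
      unfold MILCQP.conFeat
      fun_prop
    have hW : ∀ j, Continuous fun G : MILCQP m n => G.varFeat j := fun j => by
      unfold MILCQP.varFeat
      fun_prop
    exact ⟨fun i => (encoding (X := ConFeat) 1 N).continuous.comp (hV i),
      fun j => (encoding (X := VarFeat) 1 N).continuous.comp (hW j)⟩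
  | succ k ih =>
    obtain ⟨ihV, ihW⟩ := ih
    have hV : ∀ i, Continuous fun G : MILCQP m n => ((wlFeatures N G k).1 i,
        ∑ j ∈ G.conNbrs i, msg N _ ((wlFeatures N G k).2 j, G.A i j)) := fun i =>
      (ihV i).prodMk (continuous_sum_msg N _ ihW fun j => MILCQP.continuous_A_apply i j)
    have hW : ∀ j, Continuous fun G : MILCQP m n => ((wlFeatures N G k).2 j,
        ∑ i ∈ G.varConNbrs j, msg N _ ((wlFeatures N G k).1 i, G.A i j),
        ∑ j' ∈ G.varVarNbrs j, msg N _ ((wlFeatures N G k).2 j', G.Q j j')) := fun j =>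
      (ihW j).prodMk ((continuous_sum_msg N _ ihV fun i => MILCQP.continuous_A_apply i j).prodMk
        (continuous_sum_msg N _ ihW fun j' => MILCQP.continuous_Q_apply j j'))
    exact ⟨fun i => (encoding 1 N).continuous.comp (hV i),
      fun j => (encoding 1 N).continuous.comp (hW j)⟩

theorem continuous_wlReadout (N L : ℕ) :
    Continuous (wlReadout N L : MILCQP m n → _) :=
  (continuous_finsetSum _ fun i _ => (continuous_wlFeatures N L).1 i).prodMk
    (continuous_finsetSum _ fun j _ => (continuous_wlFeatures N L).2 j)

/-! Features determine colours. -/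

theorem map_eq_map_of_sum_msg_eq {ι ι' C : Type} [Fintype ι] [Fintype ι'] {N d : ℕ}
    (hι : Fintype.card ι ≤ N) (hι' : Fintype.card ι' ≤ N) {t : ι → Fin d → ℝ}
    {t' : ι' → Fin d → ℝ} {a : ι → ℝ} {a' : ι' → ℝ} {c : ι → C} {c' : ι' → C}
    (hc : ∀ i i', t i = t' i' → c i = c' i')
    (h : ∑ i ∈ Finset.univ.filter (fun i => a i ≠ 0), msg N d (t i, a i)
      = ∑ i ∈ Finset.univ.filter (fun i => a' i ≠ 0), msg N d (t' i, a' i)) :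
    ((Finset.univ.filter fun i => a i ≠ 0).val.map fun i => (c i, a i))
      = (Finset.univ.filter fun i => a' i ≠ 0).val.map fun i => (c' i, a' i) := by
  have := map_eq_map_of_sum_encoding_eq (w := .snd) (f := fun i => (t i, a i))
    (f' := fun i => (t' i, a' i)) ((Finset.card_filter_le _ _).trans hι)
    ((Finset.card_filter_le _ _).trans hι') (by simp) (by simp) h
  exact map_prodMk_eq_of_imp this hc

/-- Undoing the injective update recovers the previous feature and the message sums, and these
recover the neighbours' coloured multisets. Nodes of two different graphs are compared, as the
readout needs. -/
theorem wl_eq_of_wlFeatures_eq {N : ℕ} (hm : m ≤ N) (hn : n ≤ N) (hN : 1 ≤ N)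
    (G G' : MILCQP m n) (k : ℕ) :
    (∀ i i', (wlFeatures N G k).1 i = (wlFeatures N G' k).1 i' →
      (G.wl k).1 i = (G'.wl k).1 i') ∧
    ∀ j j', (wlFeatures N G k).2 j = (wlFeatures N G' k).2 j' →
      (G.wl k).2 j = (G'.wl k).2 j' := by
  induction k with
  | zero =>
    exact ⟨fun i i' h => encoding_injective (X := ConFeat) hN one_ne_zero one_ne_zero h,
      fun j j' h => encoding_injective (X := VarFeat) hN one_ne_zero one_ne_zero h⟩
  | succ k ih =>
    obtain ⟨ihV, ihW⟩ := ih
    constructor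
    · intro i i' h
      have := encoding_injective hN (by simp) (by simp) h
      rw [Prod.mk.injEq] at this
      exact Prod.ext (ihV _ _ this.1)
        (map_eq_map_of_sum_msg_eq (by simpa) (by simpa) ihW this.2)
    · intro j j' h
      have := encoding_injective hN (by simp) (by simp) h
      rw [Prod.mk.injEq, Prod.mk.injEq] at this
      exact Prod.ext (ihW _ _ this.1) (Prod.ext
        (map_eq_map_of_sum_msg_eq (by simpa) (by simpa) ihV this.2.1)
        (map_eq_map_of_sum_msg_eq (by simpa) (by simpa) ihW this.2.2))

theorem map_wl_eq_of_wlReadout_eq {N : ℕ} (hm : m ≤ N) (hn : n ≤ N) (hN : 1 ≤ N)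
    {G G' : MILCQP m n} {k : ℕ} (h : wlReadout N k G = wlReadout N k G') :
    Finset.univ.val.map (G.wl k).1 = Finset.univ.val.map (G'.wl k).1 ∧
      Finset.univ.val.map (G.wl k).2 = Finset.univ.val.map (G'.wl k).2 := by
  obtain ⟨hV, hW⟩ := wl_eq_of_wlFeatures_eq hm hn hN G G' k
  suffices H : Finset.univ.val.map (wlFeatures N G k).1 = Finset.univ.val.map (wlFeatures N G' k).1
      ∧ Finset.univ.val.map (wlFeatures N G k).2 = Finset.univ.val.map (wlFeatures N G' k).2 from
    ⟨map_eq_map_of_imp H.1 hV, map_eq_map_of_imp H.2 hW⟩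
  rw [wlReadout, wlReadout, Prod.mk.injEq] at h
  -- The split only exposes the outermost encoding, which is present at every layer.
  cases k with
  | zero =>
    exact ⟨map_eq_map_of_imp (map_eq_map_of_sum_encoding_eq (by simpa) (by simpa) (by simp)
        (by simp) h.1) fun i i' => congrArg _,
      map_eq_map_of_imp (map_eq_map_of_sum_encoding_eq (by simpa) (by simpa) (by simp)
        (by simp) h.2) fun i i' => congrArg _⟩
  | succ k =>
    exact ⟨map_eq_map_of_imp (map_eq_map_of_sum_encoding_eq (by simpa) (by simpa) (by simp)
        (by simp) h.1) fun i i' => congrArg _,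
      map_eq_map_of_imp (map_eq_map_of_sum_encoding_eq (by simpa) (by simpa) (by simp)
        (by simp) h.2) fun i i' => congrArg _⟩

/-- Corresponding fibres have equal cardinality; bijections between them glue to a permutation. -/
theorem exists_perm_of_map_eq {ι α : Type*} [Fintype ι] {f g : ι → α}
    (h : Finset.univ.val.map f = Finset.univ.val.map g) :
    ∃ σ : Equiv.Perm ι, ∀ i, g (σ i) = f i := by
  classical
  have hcard : ∀ c, Fintype.card {i // f i = c} = Fintype.card {i // g i = c} := fun c => by
    have := congrArg (Multiset.count c) h
    rw [Multiset.count_map, Multiset.count_map] at this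
    rw [Fintype.card_subtype, Fintype.card_subtype]
    simpa only [eq_comm, Finset.card_def, Finset.filter_val] using this
  refine ⟨((Equiv.sigmaFiberEquiv f).symm.trans (Equiv.sigmaCongrRight fun c =>
    Fintype.equivOfCardEq (hcard c))).trans (Equiv.sigmaFiberEquiv g), fun i => ?_⟩
  exact (Fintype.equivOfCardEq (hcard (f i)) ⟨i, rfl⟩).2

namespace MILCQP

/-! Stabilization of the Weisfeiler-Lehman test. -/

theorem wl_eq_of_le (G G' : MILCQP m n) {k l : ℕ} (hkl : k ≤ l) :
    (∀ i i', (G.wl l).1 i = (G'.wl l).1 i' → (G.wl k).1 i = (G'.wl k).1 i') ∧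
      ∀ j j', (G.wl l).2 j = (G'.wl l).2 j' → (G.wl k).2 j = (G'.wl k).2 j' := by
  induction l, hkl using Nat.le_induction with
  | base => exact ⟨fun _ _ => id, fun _ _ => id⟩
  | succ l _ ih =>
    exact ⟨fun i i' h => ih.1 i i' (congrArg Prod.fst h),
      fun j j' h => ih.2 j j' (congrArg Prod.fst h)⟩

/-- The two nodes of a pair have the same colour after `k` iterations. -/
def SameColor (G : MILCQP m n) (k : ℕ) : (Fin m × Fin m) ⊕ (Fin n × Fin n) → Prop :=
  Sum.elim (fun p => (G.wl k).1 p.1 = (G.wl k).1 p.2) fun p => (G.wl k).2 p.1 = (G.wl k).2 p.2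

theorem SameColor.of_le {G : MILCQP m n} {k l : ℕ} (hkl : k ≤ l) {p} (h : G.SameColor l p) :
    G.SameColor k p := by
  rcases p with p | p
  · exact (wl_eq_of_le G G hkl).1 _ _ h
  · exact (wl_eq_of_le G G hkl).2 _ _ h

/-- The next colour uses neighbours' colours one round later, and by `h` these are functions of the
colours already recorded. -/
theorem sameColor_stable_succ {G : MILCQP m n} {k : ℕ}
    (h : ∀ p, G.SameColor k p → G.SameColor (k + 1) p) (p) (hp : G.SameColor (k + 1) p) :
    G.SameColor (k + 2) p := by
  have hV : ∀ i i', (G.wl k).1 i = (G.wl k).1 i' → (G.wl (k + 1)).1 i = (G.wl (k + 1)).1 i' :=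
    fun i i' => h (.inl (i, i'))
  have hW : ∀ j j', (G.wl k).2 j = (G.wl k).2 j' → (G.wl (k + 1)).2 j = (G.wl (k + 1)).2 j' :=
    fun j j' => h (.inr (j, j'))
  rcases p with ⟨i, i'⟩ | ⟨j, j'⟩
  · have hA : ((G.conNbrs i).val.map fun j => ((G.wl k).2 j, G.A i j))
        = (G.conNbrs i').val.map fun j => ((G.wl k).2 j, G.A i' j) := congrArg Prod.snd hp
    exact Prod.ext hp (map_prodMk_eq_of_imp hA hW)
  · have hA : ((G.varConNbrs j).val.map fun i => ((G.wl k).1 i, G.A i j))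
        = (G.varConNbrs j').val.map fun i => ((G.wl k).1 i, G.A i j') :=
      congrArg (fun c => c.2.1) hp
    have hQ : ((G.varVarNbrs j).val.map fun j₁ => ((G.wl k).2 j₁, G.Q j j₁))
        = (G.varVarNbrs j').val.map fun j₁ => ((G.wl k).2 j₁, G.Q j' j₁) :=
      congrArg (fun c => c.2.2) hp
    exact Prod.ext hp (Prod.ext (map_prodMk_eq_of_imp hA hV) (map_prodMk_eq_of_imp hQ hW))

theorem sameColor_of_stable {G : MILCQP m n} {k : ℕ}
    (h : ∀ p, G.SameColor k p → G.SameColor (k + 1) p) (d : ℕ) :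
    ∀ p, G.SameColor (k + d) p → G.SameColor (k + d + 1) p := by
  induction d with
  | zero => exact h
  | succ d ih => exact sameColor_stable_succ ih

/-- The number of equally coloured pairs is at most `m * m + n * n` and drops strictly in each
unstable round. -/
theorem exists_sameColor_stable (G : MILCQP m n) :
    ∃ k ≤ m * m + n * n, ∀ p, G.SameColor k p → G.SameColor (k + 1) p := by
  classical
  by_contra! H
  let S : ℕ → Finset ((Fin m × Fin m) ⊕ (Fin n × Fin n)) :=
    fun k => Finset.univ.filter (G.SameColor k)
  have hlt : ∀ k ≤ m * m + n * n, (S (k + 1)).card < (S k).card := fun k hk => by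
    obtain ⟨p, hp, hp'⟩ := H k hk
    refine Finset.card_lt_card (Finset.ssubset_iff_subset_ne.2 ⟨fun q hq => ?_, fun hS => hp' ?_⟩)
    · exact Finset.mem_filter.2 ⟨Finset.mem_univ _,
        (Finset.mem_filter.1 hq).2.of_le k.le_succ⟩
    · have : p ∈ S k := Finset.mem_filter.2 ⟨Finset.mem_univ _, hp⟩
      rw [← hS] at this
      exact (Finset.mem_filter.1 this).2
  have hle : ∀ k ≤ m * m + n * n + 1, (S k).card + k ≤ m * m + n * n := fun k => by
    induction k with
    | zero => exact fun _ => (Finset.card_le_univ _).trans (by simp)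
    | succ k ih =>
      intro hk
      have := hlt k (by omega)
      have := ih (by omega)
      omega
  have := hle _ le_rfl
  omega

/-- The number of rounds does not depend on `G`, so one network depth serves all instances. -/
theorem sameColor_of_sameColor_card {G : MILCQP m n} {p}
    (hp : G.SameColor (m * m + n * n) p) (l : ℕ) : G.SameColor l p := by
  obtain ⟨k, hk, h⟩ := G.exists_sameColor_stable
  have key : ∀ d, G.SameColor (k + d) p := fun d => by
    induction d with
    | zero => exact hp.of_le hk
    | succ d ih => exact sameColor_of_stable h d p ih
  exact (key l).of_le (Nat.le_add_left _ _)

theorem sameClassVar_of_wl_eq {G : MILCQP m n} {j j' : Fin n}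
    (h : (G.wl (m * m + n * n)).2 j = (G.wl (m * m + n * n)).2 j') : G.SameClassVar j j' :=
  sameColor_of_sameColor_card (p := .inr (j, j')) h

/-! Tractable instances that the test does not distinguish are isomorphic. -/

theorem optValue_le_of_perm {G G' : MILCQP m n} (σ : Equiv.Perm (Fin m)) (τ : Equiv.Perm (Fin n))
    (hA : ∀ i j, G'.A (σ i) (τ j) = G.A i j) (hQ : ∀ j j', G'.Q (τ j) (τ j') = G.Q j j')
    (hcon : ∀ i, G'.conFeat (σ i) = G.conFeat i) (hvar : ∀ j, G'.varFeat (τ j) = G.varFeat j) :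
    G'.optValue ≤ G.optValue := by
  simp only [conFeat, varFeat, Prod.mk.injEq] at hcon hvar
  refine le_iInf₂ fun x hx => iInf₂_le_of_le (x ∘ τ.symm) ?_ (le_of_eq ?_)
  · obtain ⟨h₁, h₂, h₃, h₄⟩ := hx
    refine ⟨fun i => ?_, fun j => ?_, fun j => ?_, fun j => ?_⟩
    · obtain ⟨i, rfl⟩ := σ.surjective i
      have : (G'.A *ᵥ (x ∘ τ.symm)) (σ i) = (G.A *ᵥ x) i := by
        simp only [Matrix.mulVec, dotProduct]
        rw [← Equiv.sum_comp τ]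
        simp [hA]
      rw [this, (hcon i).1, (hcon i).2]
      exact h₁ i
    all_goals obtain ⟨j, rfl⟩ := τ.surjective j
    · simpa [(hvar j).2.1] using h₂ j
    · simpa [(hvar j).2.2.1] using h₃ j
    · simpa [(hvar j).2.2.2] using h₄ j
  · have hc : G'.c ⬝ᵥ (x ∘ τ.symm) = G.c ⬝ᵥ x := by
      simp only [dotProduct]
      rw [← Equiv.sum_comp τ]
      simp [hvar]
    have hq : (x ∘ τ.symm) ⬝ᵥ (G'.Q *ᵥ (x ∘ τ.symm)) = x ⬝ᵥ (G.Q *ᵥ x) := by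
      simp only [dotProduct, Matrix.mulVec]
      rw [← Equiv.sum_comp τ]
      refine Finset.sum_congr rfl fun j _ => ?_
      rw [← Equiv.sum_comp τ]
      simp [hQ]
    rw [objective, objective, hc, hq]

/-- If weights only depend on colours, then they can be read off the coloured neighbourhoods. -/
theorem weight_eq_of_map_eq {ι ι' C : Type*} [Fintype ι] [Fintype ι'] {a : ι → ℝ} {a' : ι' → ℝ}
    {c : ι → C} {c' : ι' → C} {j : ι} {j' : ι'} (hj : c' j' = c j)
    (ha : ∀ i, c i = c j → a i = a j) (ha' : ∀ i, c' i = c' j' → a' i = a' j')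
    (h : ((Finset.univ.filter fun i => a' i ≠ 0).val.map fun i => (c' i, a' i))
      = (Finset.univ.filter fun i => a i ≠ 0).val.map fun i => (c i, a i)) : a' j' = a j := by
  -- A zero weight leaves no entry in the neighbourhood multiset, so that case is argued from the
  -- other side.
  by_cases h₀ : a j = 0
  · by_contra hne
    have hmem : (c' j', a' j') ∈ (Finset.univ.filter fun i => a' i ≠ 0).val.map
        fun i => (c' i, a' i) :=
      Multiset.mem_map_of_mem _ (by simpa [h₀] using hne)
    rw [h, Multiset.mem_map] at hmem
    obtain ⟨i, -, hi⟩ := hmem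
    rw [Prod.mk.injEq] at hi
    exact hne (hi.2.symm.trans (ha i (hi.1.trans hj)))
  · have hmem : (c j, a j) ∈ (Finset.univ.filter fun i => a i ≠ 0).val.map
        fun i => (c i, a i) :=
      Multiset.mem_map_of_mem _ (by simpa using h₀)
    rw [← h, Multiset.mem_map] at hmem
    obtain ⟨i, -, hi⟩ := hmem
    rw [Prod.mk.injEq] at hi
    exact (ha' i (hi.1.trans hj.symm)).symm.trans hi.2

/-- The extra round beyond `m * m + n * n` displays each node's weighted neighbourhood in stable
colours. Colour-matching permutations then carry all data of one instance to the other. -/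
theorem MPTractable.optValue_eq {G G' : MILCQP m n} (hG : G.MPTractable) (hG' : G'.MPTractable)
    (hV : Finset.univ.val.map (G.wl (m * m + n * n + 1)).1
      = Finset.univ.val.map (G'.wl (m * m + n * n + 1)).1)
    (hW : Finset.univ.val.map (G.wl (m * m + n * n + 1)).2
      = Finset.univ.val.map (G'.wl (m * m + n * n + 1)).2) :
    G.optValue = G'.optValue := by
  obtain ⟨σ, hσ⟩ := exists_perm_of_map_eq hV
  obtain ⟨τ, hτ⟩ := exists_perm_of_map_eq hW
  have hτ' : ∀ j, (G'.wl (m * m + n * n)).2 (τ j) = (G.wl (m * m + n * n)).2 j :=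
    fun j => congrArg Prod.fst (hτ j)
  have hA : ∀ i j, G'.A (σ i) (τ j) = G.A i j := fun i j =>
    weight_eq_of_map_eq (hτ' j)
      (fun j₁ h => hG.1 _ _ _ _ (fun _ => rfl) (sameClassVar_of_wl_eq h))
      (fun j₁ h => hG'.1 _ _ _ _ (fun _ => rfl) (sameClassVar_of_wl_eq h))
      (congrArg Prod.snd (hσ i))
  have hQ : ∀ j j', G'.Q (τ j) (τ j') = G.Q j j' := fun j j' =>
    weight_eq_of_map_eq (hτ' j')
      (fun j₁ h => hG.2 _ _ _ _ (fun _ => rfl) (sameClassVar_of_wl_eq h))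
      (fun j₁ h => hG'.2 _ _ _ _ (fun _ => rfl) (sameClassVar_of_wl_eq h))
      (congrArg (fun c => c.2.2) (hτ j))
  have hcon : ∀ i, G'.conFeat (σ i) = G.conFeat i := fun i =>
    (wl_eq_of_le G' G (Nat.zero_le _)).1 _ _ (hσ i)
  have hvar : ∀ j, G'.varFeat (τ j) = G.varFeat j := fun j =>
    (wl_eq_of_le G' G (Nat.zero_le _)).2 _ _ (hτ j)
  refine le_antisymm (optValue_le_of_perm σ.symm τ.symm (fun i j => ?_) (fun j j' => ?_)
    (fun i => ?_) fun j => ?_) (optValue_le_of_perm σ τ hA hQ hcon hvar)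
  · simp [← hA]
  · simp [← hQ]
  · simp [← hcon]
  · simp [← hvar]

end MILCQP

/-! Measurability of the optimal value. -/

theorem RealOrInf.isClosed_lowerHolds : IsClosed {p : RealOrInf × ℝ | p.1.LowerHolds p.2} := by
  have : {p : RealOrInf × ℝ | p.1.LowerHolds p.2}
      = {p | isInf p.1 = 1} ∪ {p | value p.1 ≤ p.2} := by
    ext ⟨l | l, x⟩ <;> simp [LowerHolds, isInf, value]
  rw [this]
  exact (isClosed_eq (by fun_prop) (by fun_prop)).union (isClosed_le (by fun_prop) (by fun_prop))

theorem RealOrInf.isClosed_upperHolds : IsClosed {p : RealOrInf × ℝ | p.1.UpperHolds p.2} := by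
  have : {p : RealOrInf × ℝ | p.1.UpperHolds p.2}
      = {p | isInf p.1 = 1} ∪ {p | p.2 ≤ value p.1} := by
    ext ⟨l | l, x⟩ <;> simp [UpperHolds, isInf, value]
  rw [this]
  exact (isClosed_eq (by fun_prop) (by fun_prop)).union (isClosed_le (by fun_prop) (by fun_prop))

theorem ConRel.isClosed_holds : IsClosed {p : ConRel × ℝ × ℝ | p.1.Holds p.2.1 p.2.2} := by
  have : {p : ConRel × ℝ × ℝ | p.1.Holds p.2.1 p.2.2}
      = ({p | p.1 = .le} ∩ {p | p.2.1 ≤ p.2.2}) ∪ (({p | p.1 = .eq} ∩ {p | p.2.1 = p.2.2}) ∪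
        ({p | p.1 = .ge} ∩ {p | p.2.2 ≤ p.2.1})) := by
    ext ⟨r | r | r, a, b⟩ <;> simp [Holds]
  rw [this]
  have hr : ∀ r : ConRel, IsClosed {p : ConRel × ℝ × ℝ | p.1 = r} := fun r =>
    isClosed_eq continuous_fst continuous_const
  exact ((hr _).inter (isClosed_le (by fun_prop) (by fun_prop))).union
    (((hr _).inter (isClosed_eq (by fun_prop) (by fun_prop))).union
      ((hr _).inter (isClosed_le (by fun_prop) (by fun_prop))))

namespace MILCQP

theorem isClosed_feasible : IsClosed {p : MILCQP m n × (Fin n → ℝ) | p.1.Feasible p.2} := by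
  have hA : Continuous fun p : MILCQP m n × (Fin n → ℝ) => p.1.A *ᵥ p.2 :=
    (continuous_A.comp continuous_fst).matrix_mulVec continuous_snd
  simp only [Feasible, Set.ofPred_and, Set.ofPred_forall]
  refine .inter (isClosed_iInter fun i => ?_) (.inter (isClosed_iInter fun j => ?_)
    (.inter (isClosed_iInter fun j => ?_) (isClosed_iInter fun j => ?_)))
  · have : Continuous fun p : MILCQP m n × (Fin n → ℝ) =>
        (p.1.rel i, (p.1.A *ᵥ p.2) i, p.1.b i) := by fun_prop
    exact ConRel.isClosed_holds.preimage this
  · have : Continuous fun p : MILCQP m n × (Fin n → ℝ) => (p.1.l j, p.2 j) := by fun_prop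
    exact RealOrInf.isClosed_lowerHolds.preimage this
  · have : Continuous fun p : MILCQP m n × (Fin n → ℝ) => (p.1.u j, p.2 j) := by fun_prop
    exact RealOrInf.isClosed_upperHolds.preimage this
  · have hI : Continuous fun p : MILCQP m n × (Fin n → ℝ) => p.1.isInt j := by fun_prop
    -- Integrality is imposed on an open set of instances, because `Bool` is discrete.
    refine isClosed_imp ((isOpen_discrete {true}).preimage hI) ?_
    have : {p : MILCQP m n × (Fin n → ℝ) | ∃ z : ℤ, p.2 j = z}
        = (fun p => p.2 j) ⁻¹' Set.range ((↑) : ℤ → ℝ) := by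
      ext p
      simp [eq_comm]
    rw [this]
    exact Int.isClosedEmbedding_coe_real.isClosed_range.preimage (by fun_prop)

theorem continuous_objective :
    Continuous fun p : MILCQP m n × (Fin n → ℝ) => p.1.objective p.2 := by
  have hQ : Continuous fun p : MILCQP m n × (Fin n → ℝ) => p.1.Q *ᵥ p.2 :=
    (continuous_Q.comp continuous_fst).matrix_mulVec continuous_snd
  have hc : Continuous fun p : MILCQP m n × (Fin n → ℝ) => p.1.c := by fun_prop
  exact (continuous_const.mul (continuous_snd.dotProduct hQ)).add (hc.dotProduct continuous_snd)

/-- Projection along a compact factor is a closed map. -/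
theorem isClosed_exists_feasible_le (K : Set (Fin n → ℝ)) (hK : IsCompact K) (q : ℝ) :
    IsClosed {G : MILCQP m n | ∃ x ∈ K, G.Feasible x ∧ G.objective x ≤ q} := by
  have := isCompact_iff_compactSpace.1 hK
  have hC : IsClosed {p : MILCQP m n × (Fin n → ℝ) | p.1.Feasible p.2 ∧ p.1.objective p.2 ≤ q} :=
    isClosed_feasible.inter (isClosed_le continuous_objective continuous_const)
  have hproj := isClosedMap_fst_of_compactSpace (X := MILCQP m n) (Y := K) _
    (hC.preimage (continuous_id.prodMap continuous_subtype_val))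
  convert hproj using 1
  ext G
  simp [and_left_comm]

/-- Rational levels and integer radii write each strict sublevel set as a countable union of closed
sets; the infimum need not be attained. -/
theorem measurable_optValue : Measurable (optValue : MILCQP m n → EReal) := by
  refine measurable_of_Iio fun a => ?_
  have : optValue ⁻¹' Set.Iio a = ⋃ (q : ℚ) (_ : ((q : ℝ) : EReal) < a) (R : ℕ),
      {G : MILCQP m n | ∃ x ∈ Metric.closedBall (0 : Fin n → ℝ) R,
        G.Feasible x ∧ G.objective x ≤ q} := by
    ext G
    simp only [Set.mem_preimage, Set.mem_Iio, optValue, iInf_lt_iff, exists_prop, Set.mem_iUnion,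
      Set.mem_ofPred_eq]
    constructor
    · rintro ⟨x, hx, hxa⟩
      obtain ⟨q, hq, hqa⟩ := EReal.lt_iff_exists_rat_btwn.1 hxa
      obtain ⟨R, hR⟩ := exists_nat_ge ‖x‖
      exact ⟨q, hqa, R, x, by simpa using hR, hx, by exact_mod_cast hq.le⟩
    · rintro ⟨q, hqa, R, x, -, hx, hxq⟩
      exact ⟨x, hx, lt_of_le_of_lt (by exact_mod_cast hxq) hqa⟩
  rw [this]
  exact .iUnion fun q => .iUnion fun _ => .iUnion fun R =>
    (isClosed_exists_feasible_le _ (isCompact_closedBall _ _) q).measurableSet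

theorem hasFiniteValue_iff (G : MILCQP m n) :
    G.HasFiniteValue ↔ G.optValue ≠ ⊤ ∧ G.optValue ≠ ⊥ := by
  constructor
  · rintro ⟨r, hr⟩
    simp [hr]
  · rintro ⟨h₁, h₂⟩
    exact ⟨_, (EReal.coe_toReal h₁ h₂).symm⟩

theorem measurableSet_hasFiniteValue : MeasurableSet {G : MILCQP m n | G.HasFiniteValue} := by
  simp only [hasFiniteValue_iff, Set.ofPred_and]
  exact (measurable_optValue (measurableSet_singleton ⊤).compl).inter
    (measurable_optValue (measurableSet_singleton ⊥).compl)

end MILCQP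

/-! Approximation. -/

/-- **Lusin's theorem** for a finite measure that is inner regular for compact sets. -/
theorem exists_isCompact_continuousOn {X : Type*} [TopologicalSpace X] [T2Space X]
    [MeasurableSpace X] [BorelSpace X] {Y : Type*} [TopologicalSpace Y]
    [SecondCountableTopology Y] [MeasurableSpace Y] [OpensMeasurableSpace Y] (μ : Measure X)
    [IsFiniteMeasure μ] [μ.InnerRegularCompactLTTop] {f : X → Y} (hf : Measurable f) {S : Set X}
    (hS : ∀ᵐ x ∂μ, x ∈ S) {ε : ℝ≥0∞} (hε : ε ≠ 0) :
    ∃ K ⊆ S, IsCompact K ∧ ContinuousOn f K ∧ μ Kᶜ < ε := by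
  obtain ⟨ε', hε', hsum⟩ := ENNReal.exists_pos_sum_of_countable' (ENNReal.half_pos hε).ne'
    (TopologicalSpace.countableBasis Y)
  -- `S` need not be measurable: the complement of a measurable null hull of `Sᶜ` is approximated
  -- instead.
  obtain ⟨K₀, hK₀S, hK₀, hμK₀⟩ : ∃ K₀ ⊆ S, IsCompact K₀ ∧ μ K₀ᶜ < ε / 2 := by
    obtain ⟨K₀, hK₀, hK₀c, hlt⟩ := (measurableSet_toMeasurable μ Sᶜ).compl.exists_isCompact_sdiff_lt
      (measure_ne_top μ _) (ENNReal.half_pos hε).ne'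
    refine ⟨K₀, hK₀.trans (Set.compl_subset_comm.1 (subset_toMeasurable _ _)), hK₀c,
      lt_of_le_of_lt ?_ hlt⟩
    calc μ K₀ᶜ ≤ μ ((toMeasurable μ Sᶜ)ᶜ \ K₀ ∪ toMeasurable μ Sᶜ) :=
          measure_mono fun x hx => by
            by_cases h : x ∈ toMeasurable μ Sᶜ
            · exact .inr h
            · exact .inl ⟨h, hx⟩
      _ ≤ μ ((toMeasurable μ Sᶜ)ᶜ \ K₀) + μ (toMeasurable μ Sᶜ) := measure_union_le _ _
      _ = μ ((toMeasurable μ Sᶜ)ᶜ \ K₀) := by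
          have h₀ : μ Sᶜ = 0 := hS
          rw [measure_toMeasurable, h₀, add_zero]
  have hsplit : ∀ U : TopologicalSpace.countableBasis Y, ∃ A B : Set X, A ⊆ f ⁻¹' U ∧
      B ⊆ (f ⁻¹' U)ᶜ ∧ IsClosed A ∧ IsClosed B ∧ μ (A ∪ B)ᶜ ≤ ε' U := fun U => by
    have hU : MeasurableSet (f ⁻¹' U) :=
      hf (TopologicalSpace.isOpen_of_mem_countableBasis U.2).measurableSet
    obtain ⟨A, hA, hAc, hμA⟩ := hU.exists_isCompact_sdiff_lt (measure_ne_top μ _)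
      (ENNReal.half_pos (hε' U).ne').ne'
    obtain ⟨B, hB, hBc, hμB⟩ := hU.compl.exists_isCompact_sdiff_lt (measure_ne_top μ _)
      (ENNReal.half_pos (hε' U).ne').ne'
    refine ⟨A, B, hA, hB, hAc.isClosed, hBc.isClosed, ?_⟩
    calc μ (A ∪ B)ᶜ ≤ μ (f ⁻¹' U \ A ∪ (f ⁻¹' U)ᶜ \ B) := measure_mono fun x hx => by
          rw [Set.compl_union] at hx
          by_cases h : x ∈ f ⁻¹' U
          · exact .inl ⟨h, hx.1⟩
          · exact .inr ⟨h, hx.2⟩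
      _ ≤ μ (f ⁻¹' U \ A) + μ ((f ⁻¹' U)ᶜ \ B) := measure_union_le _ _
      _ ≤ ε' U / 2 + ε' U / 2 := add_le_add hμA.le hμB.le
      _ = ε' U := ENNReal.add_halves _
  choose A B hA hB hAc hBc hμ using hsplit
  refine ⟨K₀ ∩ ⋂ U, (A U ∪ B U), Set.inter_subset_left.trans hK₀S,
    hK₀.inter_right (isClosed_iInter fun U => (hAc U).union (hBc U)), fun x hx => ?_, ?_⟩
  -- If `f x ∈ U`, then `x` avoids the closed set `B U`; nearby points of the compact set avoid it
  -- too, hence lie in `A U`.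
  · refine (TopologicalSpace.isBasis_countableBasis Y).nhds_hasBasis.tendsto_right_iff.2 ?_
    rintro U ⟨hU, hxU⟩
    have hxB : x ∈ (B ⟨U, hU⟩)ᶜ := fun h => hB _ h hxU
    filter_upwards [self_mem_nhdsWithin,
      mem_nhdsWithin_of_mem_nhds ((hBc _).isOpen_compl.mem_nhds hxB)] with y hy hyB
    exact hA ⟨U, hU⟩ ((Set.mem_iInter.1 hy.2 ⟨U, hU⟩).resolve_right hyB)
  · calc μ (K₀ ∩ ⋂ U, (A U ∪ B U))ᶜ ≤ μ K₀ᶜ + μ (⋃ U, (A U ∪ B U)ᶜ) := by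
          rw [Set.compl_inter, Set.compl_iInter]
          exact measure_union_le _ _
      _ ≤ μ K₀ᶜ + ∑' U, ε' U :=
          add_le_add le_rfl ((measure_iUnion_le _).trans (ENNReal.tsum_le_tsum hμ))
      _ < ε / 2 + ε / 2 := ENNReal.add_lt_add hμK₀ hsum
      _ = ε := ENNReal.add_halves _

/-- A continuous function on a compact set that factors through a continuous map `E` into a normal
Hausdorff space factors through `E` continuously. -/
theorem exists_continuousMap_comp_eqOn {X Y : Type*} [TopologicalSpace X] [TopologicalSpace Y]
    [T2Space Y] [NormalSpace Y] {K : Set X} (hK : IsCompact K) {E : X → Y} (hE : Continuous E)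
    {f : X → ℝ} (hf : ContinuousOn f K) (hfE : ∀ x ∈ K, ∀ y ∈ K, E x = E y → f x = f y) :
    ∃ r : C(Y, ℝ), ∀ x ∈ K, r (E x) = f x := by
  have := isCompact_iff_compactSpace.1 hK
  let e : K → E '' K := fun x => ⟨E x, Set.mem_image_of_mem E x.2⟩
  have he : Continuous e := (hE.comp continuous_subtype_val).subtype_mk _
  have hsurj : Function.Surjective e := fun ⟨y, x, hx, hxy⟩ => ⟨⟨x, hx⟩, Subtype.ext hxy⟩
  -- A continuous map from a compact space to a Hausdorff space is closed, so `f` descends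
  -- continuously to the image.
  have hq : Topology.IsQuotientMap e := he.isClosedMap.isQuotientMap he hsurj
  have hfe : ∀ x y, e x = e y → f x = f y := fun x y hxy =>
    hfE x x.2 y y.2 (congrArg Subtype.val hxy)
  let φ : C(E '' K, ℝ) := hq.lift (f := ⟨e, he⟩) ⟨K.domRestrict f, hf.domRestrict⟩ hfe
  -- Tietze extension from the compact image.
  obtain ⟨r, hr⟩ := ContinuousMap.exists_restrict_eq (hK.image hE).isClosed φ
  refine ⟨r, fun x hx => ?_⟩
  have h₁ : r (E x) = φ (e ⟨x, hx⟩) := DFunLike.congr_fun hr (e ⟨x, hx⟩)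
  rw [h₁]
  exact DFunLike.congr_fun (hq.lift_comp (f := ⟨e, he⟩) ⟨K.domRestrict f, hf.domRestrict⟩ hfe)
    ⟨x, hx⟩

theorem exists_gnn_eval_eq (P : Measure (MILCQP m n)) [IsProbabilityMeasure P] [P.Regular]
    (hMP : ∀ᵐ G ∂P, G.MPTractable) {f : MILCQP m n → ℝ} (hf : Measurable f)
    (hfopt : ∀ G G' : MILCQP m n, G.optValue = G'.optValue → f G = f G') {ε : ℝ≥0∞}
    (hε : ε ≠ 0) : ∃ F : GNN, P {G | F.eval G ≠ f G} < ε := by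
  obtain ⟨K, hKS, hK, hfK, hPK⟩ :=
    exists_isCompact_continuousOn P hf (S := {G | G.MPTractable}) hMP hε
  let N := m + n + 1
  let L := m * m + n * n + 1
  obtain ⟨r, hr⟩ := exists_continuousMap_comp_eqOn hK (continuous_wlReadout N L) hfK
    fun G hG G' hG' h => by
      obtain ⟨hV, hW⟩ := map_wl_eq_of_wlReadout_eq (by omega) (by omega) (by omega) h
      exact hfopt _ _ (MILCQP.MPTractable.optValue_eq (hKS hG) (hKS hG') hV hW)
  have hsub : {G | (wlGNN N L r).eval G ≠ f G} ⊆ Kᶜ := fun G hG hGK =>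
    hG (by rw [eval_wlGNN, hr G hGK])
  exact ⟨wlGNN N L r, (measure_mono hsub).trans_lt hPK⟩

end QPGNN

end

/-! ### The two approximation statements -/

theorem theorem4p5 (m n : ℕ) (P : Measure (QPGNN.MILCQP m n))
    [IsProbabilityMeasure P] [P.Regular]
    (hMP : ∀ᵐ G ∂P, G.MPTractable) :
    (∀ ε : ℝ, 0 < ε → ∃ F₁ : QPGNN.GNN,
      P {G | ¬ (1 / 2 < F₁.eval G ↔ G.HasFiniteValue)} < ENNReal.ofReal ε) ∧
    ((∀ᵐ G ∂P, G.HasFiniteValue) →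
      ∀ ε δ : ℝ, 0 < ε → 0 < δ → ∃ F₂ : QPGNN.GNN,
        P {G | ENNReal.ofReal δ < ((F₂.eval G : EReal) - G.optValue).abs}
          < ENNReal.ofReal ε) := by
  refine ⟨fun ε hε => ?_, fun hfin ε δ hε _ => ?_⟩
  -- The target is the indicator of finite value; `1 / 2` separates its two values.
  · obtain ⟨F, hF⟩ := QPGNN.exists_gnn_eval_eq P hMP
      (measurable_const.indicator QPGNN.MILCQP.measurableSet_hasFiniteValue (f := fun _ => (1 : ℝ)))
      (fun G G' h => by
        classical
        simp only [Set.indicator_apply, Set.mem_ofPred_eq, QPGNN.MILCQP.HasFiniteValue, h])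
      (ENNReal.ofReal_pos.2 hε).ne'
    refine ⟨F, (measure_mono (Set.compl_subset_compl.2 fun G hG => ?_)).trans_lt hF⟩
    change F.eval G = _ at hG
    change 1 / 2 < F.eval G ↔ G.HasFiniteValue
    rw [hG]
    by_cases h : G.HasFiniteValue <;> simp [h]
    norm_num
  -- The target is `EReal.toReal` of the optimal value, which loses nothing where that value is
  -- finite, hence almost surely.
  · obtain ⟨F, hF⟩ := QPGNN.exists_gnn_eval_eq P hMP
      (measurable_ereal_toReal.comp QPGNN.MILCQP.measurable_optValue)
      (fun G G' h => congrArg EReal.toReal h) (ENNReal.ofReal_pos.2 hε).ne'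
    refine ⟨F, (measure_mono_ae ?_).trans_lt hF⟩
    filter_upwards [hfin] with G ⟨r, hr⟩ hG hFG
    have hFr : F.eval G = r := by rw [hFG, Function.comp_apply, hr, EReal.toReal_coe]
    change ENNReal.ofReal δ < _ at hG
    rw [hr, hFr, ← EReal.coe_sub, sub_self] at hG
    simp at hG
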